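/- Fix a number of classes $C\ge 1$ and a target class $t\in\{1,\dots,C\}$. For each $n\in\mathbb N$ let $d_n\in\mathbb N$, with $d_n\to\infty$, and consider a linear model on $\mathbb R^{d_n}$ with logits $f^{(n)}_i(\mathbf z)=\mathbf w_{n,i}^\top \mathbf z+b_{n,i}$ ($1\le i\le C$), a point $\mathbf x_n\in\mathbb R^{d_n}$ and a noise scale $\sigma_n>0$. For $i\ne t$ put $$\mathbf u_{n,i}=\mathbf w_{n,t}-\mathbf w_{n,i},\qquad c_{n,i}=\mathbf u_{n,i}^\top\mathbf x_n+(b_{n,t}-b_{n,i}),$$ assume $\mathbf u_{n,i}\neq 0$, and let $\mathbf U_n\in\mathbb R^{(C-1)\times d_n}$ be the matrix with rows $\mathbf u_{n,i}^\top/\|\mathbf u_{n,i}\|_2$, $i\ne t$. Let $\mathcal R_n$ be a probability distribution on $\mathbb R^{d_n}$ such that the coordinates $\epsilon_1,\dots,\epsilon_{d_n}$ of $\epsilon\sim\mathcal R_n$ are independent, with mean $0$ and variance $\sigma_n^2$. Assume that for every $i\ne t$ the array $X_{n,j}=(\mathbf U_n)_{ij}\,\epsilon_j$, $1\le j\le d_n$,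 satisfies Lyapunov's condition: for some $\delta>0$ all moments $\mathbb E|X_{n,j}|^{2+\delta}$ are finite and $$\frac{1}{s_n^{2+\delta}}\sum_{j=1}^{d_n}\mathbb E|X_{n,j}|^{2+\delta}\longrightarrow 0\quad(n\to\infty),\qquad s_n^2=\sum_{j=1}^{d_n}\mathrm{Var}(X_{n,j}).$$ Then the law of the normalised projections $\tfrac1{\sigma_n}\mathbf U_n\epsilon$, $\epsilon\sim\mathcal R_n$, is asymptotically $\mathcal N(0,\mathbf U_n\mathbf U_n^\top)$: for every bounded continuous $\varphi:\mathbb R^{C-1}\to\mathbb R$, $$\mathbb E_{\epsilon\sim\mathcal R_n}\,\varphi\!\left(\tfrac1{\sigma_n}\mathbf U_n\epsilon\right)-\mathbb E_{r\sim\mathcal N(0,\mathbf U_n\mathbf U_n^\top)}\,\varphi(r)\longrightarrow 0 .$$ Moreover, the average-case robustness satisfies asymptotically the formula that is exact for isotropic Gaussian noise: $$P_{\epsilon\sim\mathcal R_n}\!\left[\max_{i\neq t} f^{(n)}_i(\mathbf x_n+\epsilon)<f^{(n)}_t(\mathbf x_n+\epsilon)\right]-\Phi_{\mathbf U_n\mathbf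 U_n^\top}\!\left(\Big(\frac{c_{n,i}}{\sigma_n\|\mathbf u_{n,i}\|_2}\Big)_{i\ne t}\right)\longrightarrow 0\qquad(n\to\infty),$$ where $\Phi_{S}$ denotes the cumulative distribution function of the $(C-1)$-dimensional normal distribution with mean zero and (possibly singular) covariance matrix $S$. -/

import Mathlib

open MeasureTheory ProbabilityTheory Filter Topology
open scoped BoundedContinuousFunction

noncomputable section

namespace Robustness

/-- The average-case robustness of a classifier with logits `f` to the noise law `R` at the point
`x`, for the class `t`: the probability, for `ε ∼ R`, that `argmax_i f_i (x + ε) = t`, i.e. that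
every other logit is smaller than the logit of `t`. -/
def avgRobustness {d C : ℕ} (f : EuclideanSpace ℝ (Fin d) → Fin C → ℝ)
    (R : Measure (EuclideanSpace ℝ (Fin d))) (x : EuclideanSpace ℝ (Fin d)) (t : Fin C) : ℝ :=
  R.real {ε | ∀ i, i ≠ t → f (x + ε) i < f (x + ε) t}

/-- The logits of the multi-class linear model with weight vectors `w i` and biases `b i`. -/
def linearModel {d C : ℕ} (w : Fin C → EuclideanSpace ℝ (Fin d)) (b : Fin C → ℝ)
    (x : EuclideanSpace ℝ (Fin d)) (i : Fin C) : ℝ :=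
  inner ℝ (w i) x + b i

/-- The normal vector `u_i = w_t - w_i` of the decision boundary between the classes `t`
and `i`. -/
def boundaryWeight {d C : ℕ} (w : Fin C → EuclideanSpace ℝ (Fin d)) (t i : Fin C) :
    EuclideanSpace ℝ (Fin d) :=
  w t - w i

/-- The margin `c_i = ⟨u_i, x⟩ + (b_t - b_i)`. -/
def boundaryMargin {d C : ℕ} (w : Fin C → EuclideanSpace ℝ (Fin d)) (b : Fin C → ℝ)
    (x : EuclideanSpace ℝ (Fin d)) (t i : Fin C) : ℝ :=
  inner ℝ (boundaryWeight w t i) x + (b t - b i)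

/-- The matrix `U` with the `C - 1` rows `u_i / ‖u_i‖`, `i ≠ t`. -/
def boundaryMatrix {d C : ℕ} (w : Fin C → EuclideanSpace ℝ (Fin d)) (t : Fin C) :
    Matrix {i : Fin C // i ≠ t} (Fin d) ℝ :=
  Matrix.of fun i j => boundaryWeight w t i j / ‖boundaryWeight w t i‖

/-- The cumulative distribution function of the centred multivariate normal distribution with
(positive semidefinite, possibly singular) covariance matrix `S`. -/
def mvnCDF {ι : Type*} [Fintype ι] [DecidableEq ι] (S : Matrix ι ι ℝ) (a : ι → ℝ) : ℝ :=
  (multivariateGaussian (0 : EuclideanSpace ℝ ι) S).real {r | ∀ i, r i ≤ a i}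

/-- Coordinatewise independent noise of scale `σ`: a probability law whose coordinates are
independent, with mean `0` and variance `σ ^ 2`. -/
structure IsIndepNoise {d : ℕ} (R : Measure (EuclideanSpace ℝ (Fin d))) (σ : ℝ) : Prop where
  isProbabilityMeasure : IsProbabilityMeasure R
  indep : iIndepFun (fun (j : Fin d) (ε : EuclideanSpace ℝ (Fin d)) => ε j) R
  memLp_two : ∀ j : Fin d, MemLp (fun ε : EuclideanSpace ℝ (Fin d) => ε j) 2 R
  mean_eq_zero : ∀ j : Fin d, ∫ ε : EuclideanSpace ℝ (Fin d), ε j ∂(R) = 0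
  variance_eq : ∀ j : Fin d, variance (fun ε : EuclideanSpace ℝ (Fin d) => ε j) R = σ ^ 2

/-- Lyapunov's condition for a triangular array of random variables `X n j`, `j < k n`: for some
`δ > 0` the absolute central moments of order `2 + δ` are finite and
`(∑ j, E |X n j - E X n j| ^ (2 + δ)) / s_n ^ (2 + δ) → 0`, where `s_n ^ 2 = ∑ j, Var (X n j)`. -/
def LyapunovCondition {k : ℕ → ℕ} {Ω : ℕ → Type*} [∀ n, MeasurableSpace (Ω n)]
    (P : ∀ n, Measure (Ω n)) (X : ∀ n, Fin (k n) → Ω n → ℝ) : Prop :=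
  ∃ δ : ℝ, 0 < δ ∧
    (∀ n j, Integrable (fun ω => |X n j ω - ∫ ω', X n j ω' ∂(P n)| ^ (2 + δ)) (P n)) ∧
    Tendsto (fun n =>
      (∑ j, ∫ ω, |X n j ω - ∫ ω', X n j ω' ∂(P n)| ^ (2 + δ) ∂(P n)) /
        (√(∑ j, variance (X n j) (P n))) ^ (2 + δ)) atTop (𝓝 0)

end Robustness

end

/-!
Let `Y n = (σ n)⁻¹ U n ε` be the normalised projections and `S n = U n (U n)ᵀ`, a correlation matrix
(ones on the diagonal) since the rows of `U n` are unit vectors.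

For a fixed direction `s` the scalar `⟪s, Y n⟫` is a sum of independent centred variables with
variance `⟪s, S n s⟫`. Lyapunov's condition on each row gives a Lindeberg condition
`∑ j, E min (X j ^ 2) (|X j| ^ 3) → 0` (`LyapunovCondition.tendsto_sum_integral_truncCube`), which,
unlike Lyapunov's, does not involve the exponent `δ`, that may depend on the row, and passes to linear
combinations of the rows. The second-order Taylor expansion of the characteristic functions of the
summands, with remainder controlled by that truncated cube (`norm_integral_cexp_sum_sub_le`), shows
that the characteristic function of `Y n` at `s` minus `exp (-⟪s, S n s⟫ / 2)` tends to `0`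
(`tendsto_charFun_projection`).

The matrices `S n` need not converge, but they stay in a compact set. Along a subsequence on which
they converge to some `T`, Lévy's continuity theorem gives convergence of both `Y n` and `𝒩(0, S n)`
to `𝒩(0, T)` (`exists_subseq_tendsto_gaussian`), and it is enough to prove the claims along such
subsequences. For bounded continuous test functions this finishes the proof. For the robustness, the
event is an orthant `{r | ∀ i, r i < a n i}` for `-Y n`, with thresholds that may be unbounded. Passing
to `arctan` of coordinates and thresholds makes the thresholds converge along a subsequence as well,
and the portmanteau theorem applies because the marginals of `𝒩(0, T)` are standard normal, hence
atomless, even when `T` is singular (`tendsto_orthant`).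
-/

namespace Robustness

/-! ### The truncated cube and elementary inequalities -/

/-- The truncated cube `min (x ^ 2) (|x| ^ 3)`. Up to a constant it bounds the second-order Taylor
remainder of `x ↦ exp (i x)` on the whole line, and its expectation is finite for square-integrable
variables. -/
noncomputable def truncCube (x : ℝ) : ℝ := min (x ^ 2) (|x| ^ 3)

lemma truncCube_nonneg (x : ℝ) : 0 ≤ truncCube x := le_min (by positivity) (by positivity)

lemma truncCube_le_sq (x : ℝ) : truncCube x ≤ x ^ 2 := min_le_left _ _

@[fun_prop]
lemma continuous_truncCube : Continuous truncCube := by unfold truncCube; fun_prop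

lemma truncCube_le_truncCube {x y : ℝ} (h : |x| ≤ |y|) : truncCube x ≤ truncCube y :=
  min_le_min (sq_le_sq.2 h) (by gcongr)

lemma truncCube_mul_le (c x : ℝ) : truncCube (c * x) ≤ (c ^ 2 + |c| ^ 3) * truncCube x := by
  unfold truncCube
  rcases le_total (x ^ 2) (|x| ^ 3) with h | h
  · rw [min_eq_left h]
    refine (min_le_left _ _).trans ?_
    rw [mul_pow]
    gcongr
    linarith [pow_nonneg (abs_nonneg c) 3]
  · rw [min_eq_right h]
    refine (min_le_right _ _).trans ?_
    rw [abs_mul, mul_pow]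
    gcongr
    linarith [sq_nonneg c]

lemma truncCube_sum_le {ι : Type*} [Fintype ι] (y : ι → ℝ) :
    truncCube (∑ i, y i) ≤
      ((Fintype.card ι : ℝ) ^ 2 + (Fintype.card ι : ℝ) ^ 3) * ∑ i, truncCube (y i) := by
  rcases isEmpty_or_nonempty ι with hι | hι
  · simp [truncCube]
  obtain ⟨k, hk⟩ := Finite.exists_max fun i => |y i|
  have h1 : |∑ i, y i| ≤ |(Fintype.card ι : ℝ) * y k| := by
    rw [abs_mul, Nat.abs_cast]
    refine (Finset.abs_sum_le_sum_abs _ _).trans ?_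
    refine (Finset.sum_le_card_nsmul _ _ _ fun i _ => hk i).trans ?_
    simp
  refine (truncCube_le_truncCube h1).trans ((truncCube_mul_le _ _).trans ?_)
  rw [Nat.abs_cast]
  gcongr
  exact Finset.single_le_sum (f := fun i => truncCube (y i)) (fun i _ => truncCube_nonneg _)
    (Finset.mem_univ k)

/-- Interpolation of the truncated cube between the second moment and any moment of order `2 + δ`. The
small factor stands at the second moment, so that large `δ` is allowed too. -/
lemma truncCube_le_mul_sq_add {η : ℝ} (hη : 0 < η) {δ : ℝ} (hδ : 0 < δ) (x : ℝ) :
    truncCube x ≤ η * x ^ 2 + η ^ (-δ) * |x| ^ (2 + δ) := by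
  rcases le_or_gt |x| η with h | h
  · have h1 : truncCube x ≤ η * x ^ 2 := by
      refine (min_le_right _ _).trans ?_
      rw [← sq_abs, pow_succ, mul_comm]
      gcongr
    have : 0 ≤ η ^ (-δ) * |x| ^ (2 + δ) := by positivity
    linarith
  · have hx : 0 < |x| := hη.trans h
    have h1 : x ^ 2 ≤ η ^ (-δ) * |x| ^ (2 + δ) := by
      have h2 : |x| ^ (-δ) ≤ η ^ (-δ) := Real.rpow_le_rpow_of_nonpos hη h.le (by linarith)
      calc x ^ 2 = |x| ^ (-δ) * |x| ^ (2 + δ) := by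
            rw [← Real.rpow_add hx]
            norm_num
        _ ≤ _ := by gcongr
    have : 0 ≤ η * x ^ 2 := by positivity
    linarith [truncCube_le_sq x]

lemma sq_le_sq_add_inv_mul_truncCube {η : ℝ} (hη : 0 < η) (hη1 : η ≤ 1) (x : ℝ) :
    x ^ 2 ≤ η ^ 2 + η⁻¹ * truncCube x := by
  rcases le_or_gt |x| η with h | h
  · have h1 : x ^ 2 ≤ η ^ 2 := by rw [← sq_abs]; gcongr
    have : 0 ≤ η⁻¹ * truncCube x := mul_nonneg (by positivity) (truncCube_nonneg _)
    linarith
  · have h1 : η * x ^ 2 ≤ truncCube x := by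
      refine le_min ?_ ?_
      · exact mul_le_of_le_one_left (sq_nonneg _) hη1
      · rw [← sq_abs, pow_succ |x| 2, mul_comm]
        gcongr
    have : x ^ 2 ≤ η⁻¹ * truncCube x := by
      rw [inv_mul_eq_div, le_div_iff₀ hη]; linarith
    linarith [sq_nonneg η]

lemma norm_cexp_mul_I_sub_le (x : ℝ) :
    ‖Complex.exp (x * Complex.I) - (1 + x * Complex.I - (x : ℂ) ^ 2 / 2)‖ ≤ 4 * truncCube x := by
  have hn : ‖(x : ℂ) * Complex.I‖ = |x| := by simp
  rcases le_or_gt |x| 1 with h | h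
  · have h1 := Complex.exp_bound (x := x * Complex.I) (n := 3) (by rw [hn]; exact h) (by norm_num)
    have h2 : ∑ m ∈ Finset.range 3, ((x : ℂ) * Complex.I) ^ m / (m.factorial : ℂ) =
        1 + x * Complex.I - (x : ℂ) ^ 2 / 2 := by
      simp [Finset.sum_range_succ, Nat.factorial, mul_pow]
      ring
    rw [h2, hn] at h1
    have h3 : truncCube x = |x| ^ 3 := by
      refine min_eq_right ?_
      rw [← sq_abs]
      exact pow_le_pow_of_le_one (abs_nonneg _) h (by norm_num)
    rw [h3]
    refine h1.trans ?_
    rw [mul_comm]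
    gcongr
    norm_num [Nat.factorial]
  · have h3 : truncCube x = |x| ^ 2 := by
      rw [sq_abs]
      refine min_eq_left ?_
      rw [← sq_abs]
      exact pow_le_pow_right₀ h.le (by norm_num)
    rw [h3]
    have e1 : ‖Complex.exp (x * Complex.I)‖ = 1 := Complex.norm_exp_ofReal_mul_I x
    have e2 : ‖(x : ℂ) ^ 2 / 2‖ = |x| ^ 2 / 2 := by simp
    have e3 := norm_sub_le (Complex.exp (x * Complex.I)) (1 + x * Complex.I - (x : ℂ) ^ 2 / 2)
    have e4 := norm_sub_le (1 + x * Complex.I) ((x : ℂ) ^ 2 / 2)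
    have e5 := norm_add_le 1 ((x : ℂ) * Complex.I)
    rw [hn, norm_one] at e5
    nlinarith

lemma abs_exp_neg_sub_le {y : ℝ} (hy : 0 ≤ y) : |Real.exp (-y) - (1 - y)| ≤ y ^ 2 := by
  rcases le_or_gt y 1 with h | h
  · have := Real.norm_exp_sub_one_sub_id_le (x := -y) (by simpa [abs_of_nonneg hy] using h)
    simp only [Real.norm_eq_abs, sq_abs, neg_sq] at this
    convert! this using 2
    ring
  · have h1 := Real.add_one_le_exp (-y)
    have h2 : Real.exp (-y) ≤ 1 := Real.exp_le_one_iff.2 (by linarith)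
    rw [abs_of_nonneg (by linarith)]
    nlinarith

lemma norm_prod_sub_prod_le {κ : Type*} (s : Finset κ) (f g : κ → ℂ)
    (hf : ∀ i ∈ s, ‖f i‖ ≤ 1) (hg : ∀ i ∈ s, ‖g i‖ ≤ 1) :
    ‖∏ i ∈ s, f i - ∏ i ∈ s, g i‖ ≤ ∑ i ∈ s, ‖f i - g i‖ := by
  classical
  induction s using Finset.induction_on with
  | empty => simp
  | insert a s ha ih =>
    rw [Finset.prod_insert ha, Finset.prod_insert ha, Finset.sum_insert ha]
    have hs : ‖∏ i ∈ s, f i‖ ≤ 1 := by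
      rw [norm_prod]
      exact Finset.prod_le_one (fun _ _ => norm_nonneg _)
        fun i hi => hf i (Finset.mem_insert_of_mem hi)
    have ih' := ih (fun i hi => hf i (Finset.mem_insert_of_mem hi))
      (fun i hi => hg i (Finset.mem_insert_of_mem hi))
    have hga := hg a (Finset.mem_insert_self a s)
    calc ‖f a * ∏ i ∈ s, f i - g a * ∏ i ∈ s, g i‖
        = ‖(f a - g a) * ∏ i ∈ s, f i + g a * (∏ i ∈ s, f i - ∏ i ∈ s, g i)‖ := by
          congr 1; ring
      _ ≤ ‖f a - g a‖ * ‖∏ i ∈ s, f i‖ + ‖g a‖ * ‖∏ i ∈ s, f i - ∏ i ∈ s, g i‖ := by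
          refine (norm_add_le _ _).trans ?_
          rw [norm_mul, norm_mul]
      _ ≤ ‖f a - g a‖ * 1 + 1 * ‖∏ i ∈ s, f i - ∏ i ∈ s, g i‖ := by gcongr
      _ ≤ _ := by linarith

lemma tendsto_zero_of_le_mul_add {f : ℕ → ℝ} (hf : ∀ n, 0 ≤ f n) (K : ℝ)
    (h : ∀ η : ℝ, 0 < η → η ≤ 1 → ∃ g : ℕ → ℝ, Tendsto g atTop (𝓝 0) ∧ ∀ n, f n ≤ K * η + g n) :
    Tendsto f atTop (𝓝 0) := by
  refine tendsto_order.2 ⟨fun a ha => .of_forall fun n => ha.trans_le (hf n), fun a ha => ?_⟩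
  have hη : 0 < min 1 (a / (2 * (|K| + 1))) := by positivity
  obtain ⟨g, hg, hfg⟩ := h _ hη (min_le_left _ _)
  have hK : K * min 1 (a / (2 * (|K| + 1))) ≤ a / 2 := by
    calc K * min 1 (a / (2 * (|K| + 1))) ≤ (|K| + 1) * (a / (2 * (|K| + 1))) := by
          gcongr
          · linarith [le_abs_self K]
          · exact min_le_right _ _
      _ = a / 2 := by field_simp
  filter_upwards [hg.eventually_lt_const (half_pos ha)] with n hn
  linarith [hfg n]

/-! ### Characteristic functions of sums of independent variables -/

section

variable {Ω : Type*} [MeasurableSpace Ω] {P : Measure Ω}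

lemma integrable_truncCube {X : Ω → ℝ} (hX : MemLp X 2 P) :
    Integrable (fun ω => truncCube (X ω)) P := by
  refine hX.integrable_sq.mono' (continuous_truncCube.comp_aestronglyMeasurable hX.1)
    (.of_forall fun ω => ?_)
  rw [Real.norm_of_nonneg (truncCube_nonneg _)]
  exact truncCube_le_sq _

lemma integral_cexp_sum_eq_prod {κ : Type*} [Fintype κ] {X : κ → Ω → ℝ} (hi : iIndepFun X P)
    (hX : ∀ j, AEMeasurable (X j) P) :
    ∫ ω, Complex.exp ((∑ j, X j ω : ℝ) * Complex.I) ∂P =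
      ∏ j, ∫ ω, Complex.exp (X j ω * Complex.I) ∂P := by
  have hc : Continuous fun x : ℝ => Complex.exp (x * Complex.I) := by fun_prop
  have h := congrFun (hi.charFun_map_fun_sum_eq_prod hX) 1
  simp only [Finset.prod_apply, charFun_apply_real, Complex.ofReal_one, one_mul] at h
  rw [integral_map (Finset.aemeasurable_fun_sum _ fun j _ => hX j)
    hc.aestronglyMeasurable] at h
  rw [h]
  exact Finset.prod_congr rfl fun j _ => integral_map (hX j) hc.aestronglyMeasurable

variable [IsProbabilityMeasure P]

/-- The characteristic function of a centred square-integrable variable is close to that of the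
centred Gaussian of the same variance. -/
lemma norm_integral_cexp_sub_le {X : Ω → ℝ} (hX : MemLp X 2 P) (h0 : ∫ ω, X ω ∂P = 0) :
    ‖∫ ω, Complex.exp (X ω * Complex.I) ∂P - Complex.exp (-(∫ ω, X ω ^ 2 ∂P : ℝ) / 2)‖ ≤
      4 * ∫ ω, truncCube (X ω) ∂P + (∫ ω, X ω ^ 2 ∂P) ^ 2 := by
  set v : ℝ := ∫ ω, X ω ^ 2 ∂P with hv
  have hv0 : 0 ≤ v := integral_nonneg fun ω => sq_nonneg _
  have hX1 : Integrable X P := hX.integrable (by norm_num)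
  have iX : Integrable (fun ω => (X ω : ℂ) * Complex.I) P := hX1.ofReal.mul_const _
  have iX2 : Integrable (fun ω => (X ω : ℂ) ^ 2 / 2) P := by
    simpa using (hX.integrable_sq.ofReal (𝕜 := ℂ)).div_const 2
  have i1X : Integrable (fun ω => 1 + (X ω : ℂ) * Complex.I) P := (integrable_const _).add iX
  have iT : Integrable (fun ω => 1 + (X ω : ℂ) * Complex.I - (X ω : ℂ) ^ 2 / 2) P := i1X.sub iX2
  have iE : Integrable (fun ω => Complex.exp (X ω * Complex.I)) P := by
    refine Integrable.of_bound (C := 1) ?_ (.of_forall fun ω =>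
      (Complex.norm_exp_ofReal_mul_I _).le)
    have hc : Continuous fun x : ℝ => Complex.exp (x * Complex.I) := by fun_prop
    exact hc.comp_aestronglyMeasurable hX.1
  have hT : ∫ ω, (1 + (X ω : ℂ) * Complex.I - (X ω : ℂ) ^ 2 / 2) ∂P = 1 - (v : ℂ) / 2 := by
    rw [integral_sub i1X iX2, integral_add (integrable_const _) iX, integral_mul_const, integral_div, integral_complex_ofReal, h0]
    have : ∫ ω, (X ω : ℂ) ^ 2 ∂P = (v : ℂ) := by
      rw [hv, ← integral_complex_ofReal]
      simp
    rw [this]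
    simp
  have h1 : ‖∫ ω, Complex.exp (X ω * Complex.I) ∂P - (1 - (v : ℂ) / 2)‖ ≤
      4 * ∫ ω, truncCube (X ω) ∂P := by
    rw [← hT, ← integral_sub iE iT, ← integral_const_mul]
    exact norm_integral_le_of_norm_le ((integrable_truncCube hX).const_mul 4)
      (.of_forall fun ω => norm_cexp_mul_I_sub_le _)
  have h2 : ‖(1 - (v : ℂ) / 2) - Complex.exp (-(v : ℂ) / 2)‖ ≤ v ^ 2 := by
    have h3 := abs_exp_neg_sub_le (y := v / 2) (by positivity)
    have h4 : (1 - (v : ℂ) / 2) - Complex.exp (-(v : ℂ) / 2) =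
        ((-(Real.exp (-(v / 2)) - (1 - v / 2)) : ℝ) : ℂ) := by
      push_cast
      rw [neg_div]
      ring
    rw [h4, Complex.norm_real, norm_neg, Real.norm_eq_abs]
    refine h3.trans ?_
    nlinarith
  calc _ = ‖(∫ ω, Complex.exp (X ω * Complex.I) ∂P - (1 - (v : ℂ) / 2)) +
        ((1 - (v : ℂ) / 2) - Complex.exp (-(v : ℂ) / 2))‖ := by congr 1; ring
    _ ≤ _ := (norm_add_le _ _).trans (add_le_add h1 h2)

/-- Quantitative Lindeberg bound for the characteristic function of a sum of independent centred
variables. The parameter `η` enters through the bound `η + η⁻¹ * ∑ j, E truncCube (X j)` on the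
individual variances. -/
lemma norm_integral_cexp_sum_sub_le {κ : Type*} [Fintype κ] {X : κ → Ω → ℝ} (hi : iIndepFun X P)
    (hX : ∀ j, MemLp (X j) 2 P) (h0 : ∀ j, ∫ ω, X j ω ∂P = 0) {η : ℝ} (hη : 0 < η)
    (hη1 : η ≤ 1) :
    ‖∫ ω, Complex.exp ((∑ j, X j ω : ℝ) * Complex.I) ∂P -
        Complex.exp (-(∑ j, ∫ ω, X j ω ^ 2 ∂P : ℝ) / 2)‖ ≤
      4 * (∑ j, ∫ ω, truncCube (X j ω) ∂P) +
        (η + η⁻¹ * ∑ j, ∫ ω, truncCube (X j ω) ∂P) * ∑ j, ∫ ω, X j ω ^ 2 ∂P := by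
  have hnn : ∀ j, 0 ≤ ∫ ω, X j ω ^ 2 ∂P := fun j => integral_nonneg fun ω => sq_nonneg _
  have hΛ : ∀ j, 0 ≤ ∫ ω, truncCube (X j ω) ∂P :=
    fun j => integral_nonneg fun ω => truncCube_nonneg _
  have hexp : Complex.exp (-(∑ j, ∫ ω, X j ω ^ 2 ∂P : ℝ) / 2) =
      ∏ j, Complex.exp (-(∫ ω, X j ω ^ 2 ∂P : ℝ) / 2) := by
    rw [← Complex.exp_sum]
    congr 1
    push_cast
    rw [← Finset.sum_div, Finset.sum_neg_distrib]
  have hvar : ∀ j, ∫ ω, X j ω ^ 2 ∂P ≤ η + η⁻¹ * ∑ j, ∫ ω, truncCube (X j ω) ∂P := by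
    intro j
    have h1 : ∫ ω, X j ω ^ 2 ∂P ≤ ∫ ω, (η ^ 2 + η⁻¹ * truncCube (X j ω)) ∂P :=
      integral_mono (hX j).integrable_sq
        ((integrable_const _).add ((integrable_truncCube (hX j)).const_mul _))
        fun ω => sq_le_sq_add_inv_mul_truncCube hη hη1 _
    rw [integral_add (integrable_const _) ((integrable_truncCube (hX j)).const_mul _),
      integral_const_mul] at h1
    have h2 : ∫ ω, truncCube (X j ω) ∂P ≤ ∑ j, ∫ ω, truncCube (X j ω) ∂P :=
      Finset.single_le_sum (f := fun j => ∫ ω, truncCube (X j ω) ∂P) (fun j _ => hΛ j)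
        (Finset.mem_univ j)
    have h3 : η⁻¹ * ∫ ω, truncCube (X j ω) ∂P ≤ η⁻¹ * ∑ j, ∫ ω, truncCube (X j ω) ∂P := by
      gcongr
    simp only [integral_const, probReal_univ, one_smul] at h1
    nlinarith
  rw [integral_cexp_sum_eq_prod hi fun j => (hX j).1.aemeasurable, hexp]
  refine (norm_prod_sub_prod_le _ _ _ (fun j _ => ?_) fun j _ => ?_).trans ?_
  · refine (norm_integral_le_of_norm_le_const (C := 1) (.of_forall fun ω =>
      (Complex.norm_exp_ofReal_mul_I _).le)).trans ?_
    simp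
  · rw [Complex.norm_exp]
    refine Real.exp_le_one_iff.2 ?_
    have : (-((∫ ω, X j ω ^ 2 ∂P : ℝ) : ℂ) / 2).re = -(∫ ω, X j ω ^ 2 ∂P) / 2 := by
      simp
    rw [this]
    linarith [hnn j]
  · refine (Finset.sum_le_sum fun j _ => norm_integral_cexp_sub_le (hX j) (h0 j)).trans ?_
    rw [Finset.sum_add_distrib, ← Finset.mul_sum, Finset.mul_sum (s := Finset.univ) (a := η + _)]
    gcongr with j
    rw [sq]
    exact mul_le_mul_of_nonneg_right (hvar j) (hnn j)

end

/-- Lyapunov's condition implies a form of Lindeberg's condition in which the exponent `δ` no longer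
appears, so that it can be combined over several arrays with different exponents. -/
lemma LyapunovCondition.tendsto_sum_integral_truncCube {k : ℕ → ℕ} {Ω : ℕ → Type*}
    [∀ n, MeasurableSpace (Ω n)] {P : ∀ n, Measure (Ω n)} [∀ n, IsProbabilityMeasure (P n)]
    {X : ∀ n, Fin (k n) → Ω n → ℝ} (h : LyapunovCondition P X)
    (hX : ∀ n j, MemLp (X n j) 2 (P n)) (h0 : ∀ n j, ∫ ω, X n j ω ∂(P n) = 0)
    {s : ℕ → ℝ} (hs : ∀ n, 0 < s n) (hvar : ∀ n, ∑ j, variance (X n j) (P n) = s n ^ 2) :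
    Tendsto (fun n => ∑ j, ∫ ω, truncCube ((s n)⁻¹ * X n j ω) ∂(P n)) atTop (𝓝 0) := by
  obtain ⟨δ, hδ, hint, hlim⟩ := h
  simp only [h0, sub_zero, hvar, fun n => Real.sqrt_sq (hs n).le] at hint hlim
  refine tendsto_zero_of_le_mul_add (fun n => Finset.sum_nonneg fun j _ =>
    integral_nonneg fun ω => truncCube_nonneg _) 1 fun η hη _ =>
      ⟨fun n => η ^ (-δ) * ((∑ j, ∫ ω, |X n j ω| ^ (2 + δ) ∂(P n)) / s n ^ (2 + δ)), ?_,
        fun n => ?_⟩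
  · simpa using hlim.const_mul (η ^ (-δ))
  · have hsn := hs n
    have hsum : ∑ j, ∫ ω, ((s n)⁻¹ * X n j ω) ^ 2 ∂(P n) = 1 := by
      have : ∀ j, ∫ ω, ((s n)⁻¹ * X n j ω) ^ 2 ∂(P n) =
          (s n ^ 2)⁻¹ * variance (X n j) (P n) := by
        intro j
        rw [variance_of_integral_eq_zero (hX n j).1.aemeasurable (h0 n j), ← integral_const_mul]
        congr with ω
        rw [mul_pow, inv_pow]
      simp_rw [this]
      rw [← Finset.mul_sum, hvar, inv_mul_cancel₀ (by positivity)]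
    have hj : ∀ j, ∫ ω, truncCube ((s n)⁻¹ * X n j ω) ∂(P n) ≤
        η * ∫ ω, ((s n)⁻¹ * X n j ω) ^ 2 ∂(P n) +
          η ^ (-δ) * ((∫ ω, |X n j ω| ^ (2 + δ) ∂(P n)) / s n ^ (2 + δ)) := by
      intro j
      have hm := (hX n j).const_mul (s n)⁻¹
      have e : ∀ ω, |(s n)⁻¹ * X n j ω| ^ (2 + δ) = |X n j ω| ^ (2 + δ) / s n ^ (2 + δ) := by
        intro ω
        rw [abs_mul, abs_inv, abs_of_pos hsn, inv_mul_eq_div,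
          Real.div_rpow (abs_nonneg _) hsn.le]
      rw [← integral_div, ← integral_const_mul, ← integral_const_mul, ← integral_add
        (hm.integrable_sq.const_mul _) (((hint n j).div_const _).const_mul _)]
      refine integral_mono (integrable_truncCube hm) ((hm.integrable_sq.const_mul _).add
        (((hint n j).div_const _).const_mul _)) fun ω => ?_
      have := truncCube_le_mul_sq_add hη hδ ((s n)⁻¹ * X n j ω)
      rwa [e] at this
    refine (Finset.sum_le_sum fun j _ => hj j).trans ?_
    rw [Finset.sum_add_distrib, ← Finset.mul_sum, ← Finset.mul_sum, hsum, ← Finset.sum_div,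
      mul_one, one_mul]

/-! ### Weak convergence and orthant probabilities -/

section

variable {ι : Type*} [Fintype ι]

lemma posSemidef_of_tendsto {S : ℕ → Matrix ι ι ℝ} {T : Matrix ι ι ℝ}
    (hS : ∀ n, (S n).PosSemidef) (h : Tendsto S atTop (𝓝 T)) : T.PosSemidef := by
  refine Matrix.PosSemidef.of_dotProduct_mulVec_nonneg ?_ fun x => ?_
  · have h1 : Tendsto (fun n => (S n).conjTranspose) atTop (𝓝 T.conjTranspose) :=
      (continuous_id.matrix_conjTranspose.tendsto T).comp h
    simp only [fun n => (hS n).isHermitian.eq] at h1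
    exact tendsto_nhds_unique h1 h
  · have hc : Continuous fun M : Matrix ι ι ℝ => star x ⬝ᵥ (M.mulVec x) := by fun_prop
    exact ge_of_tendsto' ((hc.tendsto T).comp h) fun n => (hS n).dotProduct_mulVec_nonneg x

/-- Any set between the open and the closed negative orthant has its frontier in the union of the
coordinate hyperplanes. -/
lemma frontier_subset_of_orthant {E : Set (ι → ℝ)} (h1 : {z | ∀ i, z i < 0} ⊆ E)
    (h2 : E ⊆ {z | ∀ i, z i ≤ 0}) : frontier E ⊆ ⋃ i, {z | z i = 0} := by
  have hc : IsClosed {z : ι → ℝ | ∀ i, z i ≤ 0} := by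
    simp only [Set.ofPred_forall]
    exact isClosed_iInter fun i => isClosed_le (continuous_apply i) continuous_const
  have ho : IsOpen {z : ι → ℝ | ∀ i, z i < 0} := by
    simp only [Set.ofPred_forall]
    exact isOpen_iInter_of_finite fun i => isOpen_lt (continuous_apply i) continuous_const
  intro z hz
  have hz1 : ∀ i, z i ≤ 0 := closure_minimal h2 hc hz.1
  have hz2 : ¬ ∀ i, z i < 0 := fun h => hz.2 (interior_maximal h1 ho h)
  push Not at hz2
  obtain ⟨i, hi⟩ := hz2
  exact Set.mem_iUnion.2 ⟨i, le_antisymm (hz1 i) hi⟩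

/-- Orthant probabilities converge along a weakly convergent sequence whose limit has atomless
marginals, for thresholds `a n` that may escape to `±∞`: only `arctan (a n i)` is required to
converge. The set `E` allows each strict inequality `r i < a n i` to be replaced by `≤`. -/
lemma tendsto_orthant {μ : ℕ → ProbabilityMeasure (EuclideanSpace ℝ ι)}
    {ν : ProbabilityMeasure (EuclideanSpace ℝ ι)} (h : Tendsto μ atTop (𝓝 ν))
    (hν : ∀ i (c : ℝ), (ν : Measure (EuclideanSpace ℝ ι)) {r | r i = c} = 0)
    {a : ℕ → ι → ℝ} {α : ι → ℝ}
    (ha : Tendsto (fun n i => Real.arctan (a n i)) atTop (𝓝 α))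
    {E : Set (ι → ℝ)} (h1 : {z | ∀ i, z i < 0} ⊆ E) (h2 : E ⊆ {z | ∀ i, z i ≤ 0})
    (hE : MeasurableSet E) :
    Tendsto (fun n => (μ n : Measure (EuclideanSpace ℝ ι)).real
        {r | (fun i => Real.arctan (r i) - Real.arctan (a n i)) ∈ E}) atTop
      (𝓝 ((ν : Measure (EuclideanSpace ℝ ι)).real {r | ∀ i, Real.arctan (r i) < α i})) := by
  let g : EuclideanSpace ℝ ι × (ι → ℝ) → ι → ℝ := fun p i => Real.arctan (p.1 i) - p.2 i
  have hg : Continuous g := by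
    refine continuous_pi fun i => ?_
    exact (Real.continuous_arctan.comp (by fun_prop)).sub (by fun_prop)
  have hlim := ProbabilityMeasure.tendsto_map_of_tendsto_of_continuous _ _
    ((ProbabilityMeasure.continuous_prod.tendsto (ν, diracProba α)).comp
      (h.prodMk_nhds ((continuous_diracProba.tendsto α).comp ha))) hg
  -- The law of `arctan r - β` for `r ∼ m` is the image of `m × δ_β` under `g`.
  have hmap : ∀ (m : ProbabilityMeasure (EuclideanSpace ℝ ι)) (β : ι → ℝ) (A : Set (ι → ℝ)),
      MeasurableSet A →
      (((m.prod (diracProba β)).map hg.measurable.aemeasurable : ProbabilityMeasure (ι → ℝ)) :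
        Measure (ι → ℝ)) A = (m : Measure (EuclideanSpace ℝ ι))
          {r | (fun i => Real.arctan (r i) - β i) ∈ A} := by
    intro m β A hA
    rw [ProbabilityMeasure.toMeasure_map, Measure.map_apply hg.measurable hA,
      ProbabilityMeasure.toMeasure_prod]
    change ((m : Measure (EuclideanSpace ℝ ι)).prod (Measure.dirac β)) (g ⁻¹' A) = _
    rw [Measure.prod_dirac, Measure.map_apply (by fun_prop) (hg.measurable hA)]
    rfl
  have hnull : (ν : Measure (EuclideanSpace ℝ ι))
      (⋃ i, {r | Real.arctan (r i) - α i = 0}) = 0 := by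
    refine measure_iUnion_null fun i => measure_mono_null (fun r hr => ?_) (hν i (Real.tan (α i)))
    have : Real.arctan (r i) = α i := sub_eq_zero.1 hr
    simp [← this, Real.tan_arctan]
  have hfr : (((ν.prod (diracProba α)).map hg.measurable.aemeasurable :
      ProbabilityMeasure (ι → ℝ)) : Measure (ι → ℝ)) (frontier E) = 0 := by
    refine measure_mono_null (frontier_subset_of_orthant h1 h2) ?_
    rw [hmap _ _ _ (MeasurableSet.iUnion fun i =>
      measurableSet_eq_fun (measurable_pi_apply i) measurable_const)]
    simpa only [Set.mem_iUnion, Set.ofPred_exists, Set.mem_ofPred_eq] using hnull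
  have hfin := ProbabilityMeasure.tendsto_measure_of_null_frontier_of_tendsto' hlim hfr
  simp only [Function.comp_def, hmap _ _ _ hE] at hfin
  have hlimit : (ν : Measure (EuclideanSpace ℝ ι))
        {r | (fun i => Real.arctan (r i) - α i) ∈ E} =
      (ν : Measure (EuclideanSpace ℝ ι)) {r | ∀ i, Real.arctan (r i) < α i} := by
    refine le_antisymm ?_ (measure_mono fun r hr => h1 fun i => sub_neg.2 (hr i))
    rw [← add_zero ((ν : Measure (EuclideanSpace ℝ ι)) {r | ∀ i, Real.arctan (r i) < α i}),
      ← hnull]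
    refine (measure_mono fun r hr => ?_).trans (measure_union_le _ _)
    by_cases hlt : ∀ i, Real.arctan (r i) < α i
    · exact Or.inl hlt
    · push Not at hlt
      obtain ⟨i, hi⟩ := hlt
      exact Or.inr (Set.mem_iUnion.2 ⟨i, le_antisymm (h2 hr i) (sub_nonneg.2 hi)⟩)
  rw [hlimit] at hfin
  exact (ENNReal.tendsto_toReal (measure_ne_top _ _)).comp hfin

variable [DecidableEq ι]

/-- The centred Gaussian measure with covariance `S`, as a bundled probability measure. -/
noncomputable def gaussianProba (S : Matrix ι ι ℝ) : ProbabilityMeasure (EuclideanSpace ℝ ι) :=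
  ⟨multivariateGaussian 0 S, inferInstance⟩

lemma charFun_gaussianProba {S : Matrix ι ι ℝ} (hS : S.PosSemidef) (s : EuclideanSpace ℝ ι) :
    charFun (gaussianProba S : Measure (EuclideanSpace ℝ ι)) s =
      Complex.exp (-((s.ofLp ⬝ᵥ S.mulVec s.ofLp : ℝ) : ℂ) / 2) := by
  change charFun (multivariateGaussian 0 S) s = _
  rw [charFun_multivariateGaussian hS]
  simp [neg_div]

lemma gaussianProba_hyperplane {S : Matrix ι ι ℝ} (hS : S.PosSemidef) (hd : ∀ i, S i i = 1)
    (i : ι) (c : ℝ) : (gaussianProba S : Measure (EuclideanSpace ℝ ι)) {r | r i = c} = 0 := by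
  have hp := measurePreserving_eval_multivariateGaussian (μ := (0 : EuclideanSpace ℝ ι)) hS (i := i)
  have h := hp.measure_preimage (measurableSet_singleton c).nullMeasurableSet
  rw [hd] at h
  have := nullSingletonClass_gaussianReal (μ := (0 : EuclideanSpace ℝ ι) i) (v := (1 : ℝ).toNNReal)
    (by simp)
  rw [measure_singleton] at h
  exact h

/-- If the characteristic functions of `μ n` approach those of centred Gaussians with correlation
matrices `S n`, then along a subsequence both converge weakly to one and the same Gaussian, and any
given thresholds converge in the compactification of the line by `arctan`. -/
lemma exists_subseq_tendsto_gaussian {μ : ℕ → ProbabilityMeasure (EuclideanSpace ℝ ι)}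
    {S : ℕ → Matrix ι ι ℝ} (hS : ∀ n, (S n).PosSemidef) (hd : ∀ n i, S n i i = 1)
    (hb : ∀ n i j, |S n i j| ≤ 1)
    (hμ : ∀ s : EuclideanSpace ℝ ι, Tendsto (fun n =>
      charFun (μ n : Measure (EuclideanSpace ℝ ι)) s -
        Complex.exp (-((s.ofLp ⬝ᵥ (S n).mulVec s.ofLp : ℝ) : ℂ) / 2)) atTop (𝓝 0))
    (a : ℕ → ι → ℝ) :
    ∃ (m : ℕ → ℕ) (T : Matrix ι ι ℝ) (α : ι → ℝ), T.PosSemidef ∧ (∀ i, T i i = 1) ∧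
      Tendsto (fun n => μ (m n)) atTop (𝓝 (gaussianProba T)) ∧
      Tendsto (fun n => gaussianProba (S (m n))) atTop (𝓝 (gaussianProba T)) ∧
      Tendsto (fun n i => Real.arctan (a (m n) i)) atTop (𝓝 α) := by
  have hK : IsCompact ((Set.univ.pi fun _ : ι => Set.univ.pi fun _ : ι => Set.Icc (-1 : ℝ) 1) ×ˢ
      (Set.univ.pi fun _ : ι => Set.Icc (-(Real.pi / 2)) (Real.pi / 2))) :=
    (isCompact_univ_pi fun _ => isCompact_univ_pi fun _ => isCompact_Icc).prod
      (isCompact_univ_pi fun _ => isCompact_Icc)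
  obtain ⟨⟨T, α⟩, -, m, hm, hlim⟩ := hK.tendsto_subseq
    (x := fun n => (fun i j => S n i j, fun i => Real.arctan (a n i)))
    fun n => ⟨fun i _ j _ => abs_le.1 (hb n i j), fun i _ =>
      ⟨(Real.neg_pi_div_two_lt_arctan _).le, (Real.arctan_lt_pi_div_two _).le⟩⟩
  have hT : Tendsto (fun n => S (m n)) atTop (𝓝 (T : Matrix ι ι ℝ)) := hlim.fst_nhds
  have hTS := posSemidef_of_tendsto (fun n => hS (m n)) hT
  have hexp : ∀ s : EuclideanSpace ℝ ι, Tendsto (fun n =>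
      Complex.exp (-((s.ofLp ⬝ᵥ (S (m n)).mulVec s.ofLp : ℝ) : ℂ) / 2)) atTop
      (𝓝 (charFun (gaussianProba T : Measure (EuclideanSpace ℝ ι)) s)) := by
    intro s
    rw [charFun_gaussianProba hTS]
    have hc : Continuous fun M : Matrix ι ι ℝ =>
        Complex.exp (-((s.ofLp ⬝ᵥ M.mulVec s.ofLp : ℝ) : ℂ) / 2) := by fun_prop
    exact (hc.tendsto T).comp hT
  refine ⟨m, T, α, hTS, fun i => ?_, ?_, ?_, hlim.snd_nhds⟩
  · have h1 : Tendsto (fun n => S (m n) i i) atTop (𝓝 (T i i)) :=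
      ((continuous_id.matrix_elem i i).tendsto T).comp hT
    simp only [hd] at h1
    exact tendsto_nhds_unique h1 tendsto_const_nhds
  · refine ProbabilityMeasure.tendsto_of_tendsto_charFun fun s => ?_
    simpa using ((hμ s).comp hm.tendsto_atTop).add (hexp s)
  · refine ProbabilityMeasure.tendsto_of_tendsto_charFun fun s => ?_
    simpa only [charFun_gaussianProba (hS _)] using hexp s

/-- Pointwise asymptotic equality of characteristic functions with those of the Gaussians
`𝒩(0, S n)` gives asymptotic equality in law, without convergence of the `S n`. -/
lemma tendsto_integral_sub_integral_gaussianProba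
    {μ : ℕ → ProbabilityMeasure (EuclideanSpace ℝ ι)}
    {S : ℕ → Matrix ι ι ℝ} (hS : ∀ n, (S n).PosSemidef) (hd : ∀ n i, S n i i = 1)
    (hb : ∀ n i j, |S n i j| ≤ 1)
    (hμ : ∀ s : EuclideanSpace ℝ ι, Tendsto (fun n =>
      charFun (μ n : Measure (EuclideanSpace ℝ ι)) s -
        Complex.exp (-((s.ofLp ⬝ᵥ (S n).mulVec s.ofLp : ℝ) : ℂ) / 2)) atTop (𝓝 0))
    (φ : EuclideanSpace ℝ ι →ᵇ ℝ) :
    Tendsto (fun n => ∫ r, φ r ∂(μ n : Measure (EuclideanSpace ℝ ι)) -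
      ∫ r, φ r ∂(gaussianProba (S n) : Measure (EuclideanSpace ℝ ι))) atTop (𝓝 0) := by
  refine tendsto_of_subseq_tendsto fun ns hns => ?_
  obtain ⟨m, T, α, -, -, h1, h2, -⟩ := exists_subseq_tendsto_gaussian (fun n => hS (ns n))
    (fun n => hd (ns n)) (fun n => hb (ns n)) (fun s => (hμ s).comp hns) 0
  refine ⟨m, ?_⟩
  simpa using (ProbabilityMeasure.tendsto_iff_forall_integral_tendsto.1 h1 φ).sub
    (ProbabilityMeasure.tendsto_iff_forall_integral_tendsto.1 h2 φ)

/-- Orthant probabilities agree asymptotically with those of `𝒩(0, S n)`, for arbitrary thresholds,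
unbounded ones included. -/
lemma tendsto_orthant_sub_orthant_gaussianProba
    {μ : ℕ → ProbabilityMeasure (EuclideanSpace ℝ ι)}
    {S : ℕ → Matrix ι ι ℝ} (hS : ∀ n, (S n).PosSemidef) (hd : ∀ n i, S n i i = 1)
    (hb : ∀ n i j, |S n i j| ≤ 1)
    (hμ : ∀ s : EuclideanSpace ℝ ι, Tendsto (fun n =>
      charFun (μ n : Measure (EuclideanSpace ℝ ι)) s -
        Complex.exp (-((s.ofLp ⬝ᵥ (S n).mulVec s.ofLp : ℝ) : ℂ) / 2)) atTop (𝓝 0))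
    (a : ℕ → ι → ℝ) :
    Tendsto (fun n => (μ n : Measure (EuclideanSpace ℝ ι)).real {r | ∀ i, r i < a n i} -
      (gaussianProba (S n) : Measure (EuclideanSpace ℝ ι)).real {r | ∀ i, r i ≤ a n i})
      atTop (𝓝 0) := by
  refine tendsto_of_subseq_tendsto fun ns hns => ?_
  obtain ⟨m, T, α, hT, hTd, h1, h2, hα⟩ := exists_subseq_tendsto_gaussian (fun n => hS (ns n))
    (fun n => hd (ns n)) (fun n => hb (ns n)) (fun s => (hμ s).comp hns) (fun n => a (ns n))
  refine ⟨m, ?_⟩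
  have hle : {z : ι → ℝ | ∀ i, z i < 0} ⊆ {z | ∀ i, z i ≤ 0} := fun z hz i => (hz i).le
  have k1 := tendsto_orthant h1 (gaussianProba_hyperplane hT hTd) hα subset_rfl hle
    (by simp only [Set.ofPred_forall]; exact .iInter fun i =>
      measurableSet_lt (measurable_pi_apply i) measurable_const)
  have k2 := tendsto_orthant h2 (gaussianProba_hyperplane hT hTd) hα hle subset_rfl
    (by simp only [Set.ofPred_forall]; exact .iInter fun i =>
      measurableSet_le (measurable_pi_apply i) measurable_const)
  simp only [Set.mem_ofPred_eq, sub_neg, sub_nonpos, Real.arctan_strictMono.lt_iff_lt,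
    Real.arctan_strictMono.le_iff_le] at k1 k2
  simpa using k1.sub k2

end

/-! ### Projections of independent noise and the linear model -/

section

variable {ι : Type*} [Fintype ι]

lemma IsIndepNoise.integral_sq {d : ℕ} {R : Measure (EuclideanSpace ℝ (Fin d))} {σ : ℝ}
    (h : IsIndepNoise R σ) (j : Fin d) :
    ∫ ε : EuclideanSpace ℝ (Fin d), ε j ^ 2 ∂(R) = σ ^ 2 := by
  rw [← h.variance_eq j, variance_of_integral_eq_zero (h.memLp_two j).1.aemeasurable
    (h.mean_eq_zero j)]

lemma dotProduct_mul_transpose_mulVec {d : ℕ} (U : Matrix ι (Fin d) ℝ) (s : ι → ℝ) :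
    s ⬝ᵥ (U * U.transpose).mulVec s = ∑ j, (∑ i, s i * U i j) ^ 2 := by
  rw [← Matrix.mulVec_mulVec, Matrix.dotProduct_mulVec, Matrix.mulVec_transpose]
  simp only [dotProduct, Matrix.vecMul, sq]

/-- For any direction `s`, the characteristic functions of the projections `σ⁻¹ U ε` approach those
of `𝒩(0, U Uᵀ)`: the Lindeberg quantity of the one-dimensional array `⟪s, σ⁻¹ U ε⟫` is controlled by
those of the rows of `U`. -/
lemma tendsto_charFun_projection {d : ℕ → ℕ} {U : ∀ n, Matrix ι (Fin (d n)) ℝ} {σ : ℕ → ℝ}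
    (hσ : ∀ n, 0 < σ n) {R : ∀ n, Measure (EuclideanSpace ℝ (Fin (d n)))}
    (hR : ∀ n, IsIndepNoise (R n) (σ n)) (hb : ∀ n i k, |(U n * (U n).transpose) i k| ≤ 1)
    (hΛ : ∀ i, Tendsto (fun n => ∑ j, ∫ ε, truncCube ((σ n)⁻¹ * (U n i j * ε j)) ∂(R n))
      atTop (𝓝 0)) (s : EuclideanSpace ℝ ι) :
    Tendsto (fun n =>
      charFun ((R n).map fun ε => WithLp.toLp 2 ((σ n)⁻¹ • (U n).mulVec (WithLp.ofLp ε))) s -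
        Complex.exp (-((s.ofLp ⬝ᵥ (U n * (U n).transpose).mulVec s.ofLp : ℝ) : ℂ) / 2))
      atTop (𝓝 0) := by
  set K : ℝ := (Fintype.card ι : ℝ) ^ 2 + (Fintype.card ι : ℝ) ^ 3 with hK
  set B : ℝ := ∑ i, ∑ k, |s i| * |s k| with hB
  let Λ : ℕ → ℝ := fun n => K * ∑ i, (s i ^ 2 + |s i| ^ 3) *
    ∑ j, ∫ ε, truncCube ((σ n)⁻¹ * (U n i j * ε j)) ∂(R n)
  have hΛ0 : Tendsto Λ atTop (𝓝 0) := by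
    have := (tendsto_finsetSum Finset.univ fun i _ =>
      (hΛ i).const_mul (s i ^ 2 + |s i| ^ 3)).const_mul K
    simpa using this
  refine tendsto_zero_iff_norm_tendsto_zero.2 (tendsto_zero_of_le_mul_add
    (fun _ => norm_nonneg _) B fun η hη hη1 => ⟨fun n => 4 * Λ n + η⁻¹ * Λ n * B, ?_,
      fun n => ?_⟩)
  · simpa using (hΛ0.const_mul 4).add ((hΛ0.const_mul η⁻¹).mul_const B)
  have := (hR n).isProbabilityMeasure
  have hσn := hσ n
  let c : Fin (d n) → ℝ := fun j => (σ n)⁻¹ * ∑ i, s i * U n i j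
  have hX : ∀ j, MemLp (fun ε : EuclideanSpace ℝ (Fin (d n)) => c j * ε j) 2 (R n) :=
    fun j => ((hR n).memLp_two j).const_mul _
  have hrow : ∀ i j, MemLp
      (fun ε : EuclideanSpace ℝ (Fin (d n)) => (σ n)⁻¹ * (U n i j * ε j)) 2 (R n) :=
    fun i j => (((hR n).memLp_two j).const_mul _).const_mul _
  have hind : iIndepFun (fun j (ε : EuclideanSpace ℝ (Fin (d n))) => c j * ε j) (R n) :=
    (hR n).indep.comp (fun j x => c j * x) fun j => by fun_prop
  have h0 : ∀ j, ∫ ε : EuclideanSpace ℝ (Fin (d n)), c j * ε j ∂(R n) = 0 := fun j => by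
    rw [integral_const_mul, (hR n).mean_eq_zero j, mul_zero]
  have hsq : ∑ j, ∫ ε : EuclideanSpace ℝ (Fin (d n)), (c j * ε j) ^ 2 ∂(R n) =
      s.ofLp ⬝ᵥ (U n * (U n).transpose).mulVec s.ofLp := by
    rw [dotProduct_mul_transpose_mulVec]
    refine Finset.sum_congr rfl fun j _ => ?_
    simp_rw [mul_pow]
    rw [integral_const_mul, (hR n).integral_sq j]
    simp only [c]
    field_simp
  have hQ : s.ofLp ⬝ᵥ (U n * (U n).transpose).mulVec s.ofLp ≤ B := by
    rw [dotProduct, hB]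
    refine Finset.sum_le_sum fun i _ => ?_
    rw [Matrix.mulVec, dotProduct, Finset.mul_sum]
    refine Finset.sum_le_sum fun k _ => (le_abs_self _).trans ?_
    rw [abs_mul, abs_mul]
    gcongr
    exact mul_le_of_le_one_left (abs_nonneg _) (hb n i k)
  have hL : ∑ j, ∫ ε : EuclideanSpace ℝ (Fin (d n)), truncCube (c j * ε j) ∂(R n) ≤ Λ n := by
    have hpt : ∀ j (ε : EuclideanSpace ℝ (Fin (d n))), truncCube (c j * ε j) ≤
        K * ∑ i, (s i ^ 2 + |s i| ^ 3) * truncCube ((σ n)⁻¹ * (U n i j * ε j)) := by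
      intro j ε
      have e : c j * ε j = ∑ i, s i * ((σ n)⁻¹ * (U n i j * ε j)) := by
        simp only [c, Finset.mul_sum, Finset.sum_mul]
        exact Finset.sum_congr rfl fun i _ => by ring
      rw [e]
      refine (truncCube_sum_le _).trans ?_
      gcongr with i
      exact truncCube_mul_le _ _
    have hint : ∀ j i, Integrable (fun ε : EuclideanSpace ℝ (Fin (d n)) =>
        (s i ^ 2 + |s i| ^ 3) * truncCube ((σ n)⁻¹ * (U n i j * ε j))) (R n) :=
      fun j i => (integrable_truncCube (hrow i j)).const_mul _
    calc _ ≤ ∑ j, ∫ ε : EuclideanSpace ℝ (Fin (d n)),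
          K * ∑ i, (s i ^ 2 + |s i| ^ 3) * truncCube ((σ n)⁻¹ * (U n i j * ε j)) ∂(R n) :=
          Finset.sum_le_sum fun j _ => integral_mono (integrable_truncCube (hX j))
            ((integrable_finsetSum _ fun i _ => hint j i).const_mul _) (hpt j)
      _ = Λ n := by
          simp only [Λ]
          simp_rw [integral_const_mul, integral_finsetSum _ fun i _ => hint _ i,
            integral_const_mul]
          rw [← Finset.mul_sum, Finset.sum_comm]
          simp_rw [Finset.mul_sum]
  have hL0 : 0 ≤ ∑ j, ∫ ε : EuclideanSpace ℝ (Fin (d n)), truncCube (c j * ε j) ∂(R n) :=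
    Finset.sum_nonneg fun j _ => integral_nonneg fun ε => truncCube_nonneg _
  have hch : charFun ((R n).map fun ε =>
        WithLp.toLp 2 ((σ n)⁻¹ • (U n).mulVec (WithLp.ofLp ε))) s =
      ∫ ε : EuclideanSpace ℝ (Fin (d n)),
        Complex.exp ((∑ j, c j * ε j : ℝ) * Complex.I) ∂(R n) := by
    rw [charFun_apply, integral_map (Continuous.aemeasurable (by fun_prop))
      (Continuous.aestronglyMeasurable (by fun_prop))]
    congr with ε
    congr 3
    rw [PiLp.inner_apply]
    simp only [c, Pi.smul_apply, Matrix.mulVec, dotProduct, smul_eq_mul, Finset.mul_sum,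
      Finset.sum_mul, RCLike.inner_apply, conj_trivial]
    rw [Finset.sum_comm]
    exact Finset.sum_congr rfl fun j _ => Finset.sum_congr rfl fun i _ => by ring
  have key := norm_integral_cexp_sum_sub_le hind hX h0 hη hη1
  rw [hsq] at key
  rw [hch]
  have hQ0 : 0 ≤ s.ofLp ⬝ᵥ (U n * (U n).transpose).mulVec s.ofLp := by
    rw [dotProduct_mul_transpose_mulVec]
    positivity
  refine key.trans ?_
  have hmul : (η + η⁻¹ * ∑ j, ∫ ε : EuclideanSpace ℝ (Fin (d n)), truncCube (c j * ε j) ∂(R n)) *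
      (s.ofLp ⬝ᵥ (U n * (U n).transpose).mulVec s.ofLp) ≤ (η + η⁻¹ * Λ n) * B := by
    gcongr
    exact add_nonneg hη.le (mul_nonneg (by positivity) (hL0.trans hL))
  linarith

end

section

variable {d C : ℕ} {w : Fin C → EuclideanSpace ℝ (Fin d)} {t : Fin C}

lemma boundaryMatrix_mul_transpose_apply (i k : {i : Fin C // i ≠ t}) :
    (boundaryMatrix w t * (boundaryMatrix w t).transpose) i k =
      inner ℝ (boundaryWeight w t i) (boundaryWeight w t k) /
        (‖boundaryWeight w t i‖ * ‖boundaryWeight w t k‖) := by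
  rw [Matrix.mul_apply, PiLp.inner_apply, Finset.sum_div]
  refine Finset.sum_congr rfl fun j _ => ?_
  simp only [boundaryMatrix, Matrix.of_apply, Matrix.transpose_apply, RCLike.inner_apply,
    conj_trivial]
  ring

lemma boundaryMatrix_mul_transpose_self (hu : ∀ i, i ≠ t → boundaryWeight w t i ≠ 0)
    (i : {i : Fin C // i ≠ t}) :
    (boundaryMatrix w t * (boundaryMatrix w t).transpose) i i = 1 := by
  rw [boundaryMatrix_mul_transpose_apply, real_inner_self_eq_norm_mul_norm]
  have := norm_ne_zero_iff.2 (hu i i.2)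
  field_simp

lemma abs_boundaryMatrix_mul_transpose_le (i k : {i : Fin C // i ≠ t}) :
    |(boundaryMatrix w t * (boundaryMatrix w t).transpose) i k| ≤ 1 := by
  rw [boundaryMatrix_mul_transpose_apply]
  exact abs_real_inner_div_norm_mul_norm_le_one _ _

lemma boundaryMatrix_posSemidef :
    (boundaryMatrix w t * (boundaryMatrix w t).transpose).PosSemidef := by
  simpa using Matrix.posSemidef_self_mul_conjTranspose (boundaryMatrix w t)

/-- The class `t` wins against `i` at `x + ε` iff the projection of `-ε` onto the unit normal of the
decision boundary stays below the signed distance of `x` to that boundary, both measured in units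
of `σ`. -/
lemma linearModel_lt_iff (hu : ∀ i, i ≠ t → boundaryWeight w t i ≠ 0) (b : Fin C → ℝ)
    (x ε : EuclideanSpace ℝ (Fin d)) {σ : ℝ} (hσ : 0 < σ) (i : {i : Fin C // i ≠ t}) :
    linearModel w b (x + ε) i < linearModel w b (x + ε) t ↔
      (σ⁻¹ • (-boundaryMatrix w t).mulVec ε.ofLp) i <
        boundaryMargin w b x t i / (σ * ‖boundaryWeight w t i‖) := by
  have hn : 0 < ‖boundaryWeight w t i‖ := norm_pos_iff.2 (hu i i.2)
  have hU : (boundaryMatrix w t).mulVec ε.ofLp i =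
      inner ℝ (boundaryWeight w t i) ε / ‖boundaryWeight w t i‖ := by
    rw [Matrix.mulVec, dotProduct, PiLp.inner_apply, Finset.sum_div]
    refine Finset.sum_congr rfl fun j _ => ?_
    simp only [boundaryMatrix, Matrix.of_apply, RCLike.inner_apply, conj_trivial]
    ring
  have e1 : (σ⁻¹ • (-boundaryMatrix w t).mulVec ε.ofLp) i =
      -inner ℝ (boundaryWeight w t i) ε / (σ * ‖boundaryWeight w t i‖) := by
    rw [Pi.smul_apply, Matrix.neg_mulVec, Pi.neg_apply, hU, smul_eq_mul]
    field_simp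
  rw [e1, div_lt_div_iff_of_pos_right (by positivity)]
  simp only [linearModel, boundaryMargin, boundaryWeight, inner_add_right, inner_sub_left]
  constructor <;> intro h <;> linarith

end

end Robustness

theorem lemma2 {C : ℕ} (t : Fin C)
    (d : ℕ → ℕ) (hd : Tendsto d atTop atTop)
    (w : ∀ n, Fin C → EuclideanSpace ℝ (Fin (d n)))
    (b : ℕ → Fin C → ℝ)
    (x : ∀ n, EuclideanSpace ℝ (Fin (d n)))
    (hu : ∀ n i, i ≠ t → Robustness.boundaryWeight (w n) t i ≠ 0)
    (σ : ℕ → ℝ) (hσ : ∀ n, 0 < σ n)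
    (R : ∀ n, Measure (EuclideanSpace ℝ (Fin (d n))))
    (hR : ∀ n, Robustness.IsIndepNoise (R n) (σ n))
    (hLyapunov : ∀ i : {i : Fin C // i ≠ t}, Robustness.LyapunovCondition R
      (fun n j ε => Robustness.boundaryMatrix (w n) t i j * ε j)) :
    (∀ φ : EuclideanSpace ℝ {i : Fin C // i ≠ t} →ᵇ ℝ,
      Tendsto (fun n =>
        (∫ ε, φ (WithLp.toLp 2
          ((σ n)⁻¹ • (Robustness.boundaryMatrix (w n) t).mulVec (WithLp.ofLp ε))) ∂(R n)) -
        (∫ r, φ r ∂(multivariateGaussian 0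
          (Robustness.boundaryMatrix (w n) t * (Robustness.boundaryMatrix (w n) t).transpose))))
        atTop (𝓝 0)) ∧
    Tendsto (fun n =>
      Robustness.avgRobustness (Robustness.linearModel (w n) (b n)) (R n) (x n) t -
      Robustness.mvnCDF
        (Robustness.boundaryMatrix (w n) t * (Robustness.boundaryMatrix (w n) t).transpose)
        (fun i => Robustness.boundaryMargin (w n) (b n) (x n) t i /
          (σ n * ‖Robustness.boundaryWeight (w n) t i‖)))
      atTop (𝓝 0) := by
  have := fun n => (hR n).isProbabilityMeasure
  let U := fun n => Robustness.boundaryMatrix (w n) t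
  have hS : ∀ n, (U n * (U n).transpose).PosSemidef := fun n =>
    Robustness.boundaryMatrix_posSemidef
  have hdiag : ∀ n i, (U n * (U n).transpose) i i = 1 := fun n =>
    Robustness.boundaryMatrix_mul_transpose_self (hu n)
  have hb : ∀ n i k, |(U n * (U n).transpose) i k| ≤ 1 := fun n =>
    Robustness.abs_boundaryMatrix_mul_transpose_le
  have hΛ : ∀ i, Tendsto (fun n =>
      ∑ j, ∫ ε, Robustness.truncCube ((σ n)⁻¹ * (U n i j * ε j)) ∂(R n)) atTop (𝓝 0) := by
    intro i
    refine (hLyapunov i).tendsto_sum_integral_truncCube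
      (fun n j => ((hR n).memLp_two j).const_mul _) (fun n j => ?_) hσ fun n => ?_
    · rw [integral_const_mul, (hR n).mean_eq_zero, mul_zero]
    · simp_rw [variance_const_mul, (hR n).variance_eq]
      rw [← Finset.sum_mul]
      have := hdiag n i
      simp only [Matrix.mul_apply, Matrix.transpose_apply, ← sq] at this
      rw [this, one_mul]
  have hcont : ∀ n (V : Matrix {i : Fin C // i ≠ t} (Fin (d n)) ℝ), Continuous
      fun ε : EuclideanSpace ℝ (Fin (d n)) =>
        (WithLp.toLp 2 ((σ n)⁻¹ • V.mulVec ε.ofLp) : EuclideanSpace ℝ {i : Fin C // i ≠ t}) :=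
    fun n V => by fun_prop
  let μ : (V : ∀ n, Matrix {i : Fin C // i ≠ t} (Fin (d n)) ℝ) → ℕ →
      ProbabilityMeasure (EuclideanSpace ℝ {i : Fin C // i ≠ t}) := fun V n =>
    ⟨(R n).map fun ε => WithLp.toLp 2 ((σ n)⁻¹ • (V n).mulVec ε.ofLp),
      Measure.isProbabilityMeasure_map (hcont n (V n)).aemeasurable⟩
  refine ⟨fun φ => ?_, ?_⟩
  · have h := Robustness.tendsto_integral_sub_integral_gaussianProba (μ := μ U) hS hdiag hb
      (Robustness.tendsto_charFun_projection hσ hR hb hΛ) φ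
    refine h.congr fun n => ?_
    congr 1
    exact integral_map (hcont n (U n)).aemeasurable φ.continuous.aestronglyMeasurable
  · -- The event is an orthant for the projections of `-ε`, hence the matrices `-U n`, whose Gram
    -- matrices are those of `U n`.
    have hneg : ∀ n, (-U n) * (-U n).transpose = U n * (U n).transpose := fun n => by simp
    have hch := Robustness.tendsto_charFun_projection (U := fun n => -U n) hσ hR
      (fun n => by rw [hneg]; exact hb n)
      (by simpa [Robustness.truncCube] using hΛ)
    simp only [hneg] at hch
    have h := Robustness.tendsto_orthant_sub_orthant_gaussianProba (μ := μ fun n => -U n) hS hdiag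
      hb hch fun n i => Robustness.boundaryMargin (w n) (b n) (x n) t i /
        (σ n * ‖Robustness.boundaryWeight (w n) t i‖)
    refine h.congr fun n => ?_
    congr 1
    have hm : MeasurableSet {r : EuclideanSpace ℝ {i : Fin C // i ≠ t} | ∀ i, r i <
        Robustness.boundaryMargin (w n) (b n) (x n) t i /
          (σ n * ‖Robustness.boundaryWeight (w n) t i‖)} := by
      simp only [Set.ofPred_forall]
      exact .iInter fun i => measurableSet_lt (by fun_prop) measurable_const
    rw [Robustness.avgRobustness]
    refine (map_measureReal_apply (hcont n (-U n)).measurable hm).trans ?_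
    congr 1
    ext ε
    exact ⟨fun h i hi => (Robustness.linearModel_lt_iff (hu n) (b n) (x n) ε (hσ n) ⟨i, hi⟩).2
      (h ⟨i, hi⟩), fun h i => (Robustness.linearModel_lt_iff (hu n) (b n) (x n) ε (hσ n) i).1
        (h i i.2)⟩
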